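/- Throughout, a local coefficient system on a space $E$ is a functor $\mathcal F$ from the fundamental groupoid of $E$ to abelian groups; it is called abelian if, at every base point, the monodromy of $\mathcal F$ around every commutator loop is trivial. $H_*(E;\mathcal F)$ denotes singular homology with coefficients in $\mathcal F$. Let $r\colon Y\to X$ be a continuous map of topological spaces and $Z\subseteq X$ a subspace. For $U\subseteq X$, let $\mathit{hofib}_U(r)$ be the homotopy limit of $U\to X\xleftarrow{\;r\;}Y$, i.e. the space of pairs $(\gamma,y)$ with $y\in Y$ and $\gamma\colon[0,1]\to X$ a path with $\gamma(0)\in U$ and $\gamma(1)=r(y)$; write $\mathit{hofib}_z(r)=\mathit{hofib}_{\{z\}}(r)$. Let $r|_Z\colon r^{-1}(Z)\to Z$ be the restriction of $r$ (so in $\mathit{hofib}_z(r|_Z)$ the paths stay in $Z$). The map $r$ is a twisted (resp. abelian) Serre homology fibration on $Z$ if for all $z\in Z$ and every (resp. every abelian) local coefficient system $\mathcal F$ on $\mathit{hofib}_z(r)$, the natural inclusions $i\colon r^{-1}(z)\to\mathit{hofib}_z(r|_Z)$ (constant paths) and $j\colon\mathit{hofib}_z(r|_Z)\to\mathit{hofib}_z(r)$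 are such that $$i_*\colon H_*(r^{-1}(z);i^*j^*\mathcal F)\to H_*(\mathit{hofib}_z(r|_Z);j^*\mathcal F)$$ is an isomorphism. The map $r$ is a twisted (resp. abelian) Leray homology fibration on $Z$ if the topology of $Z$ has a basis $\mathcal U$ consisting of contractible sets such that for all $z\in U\in\mathcal U$ and every (resp. every abelian) local coefficient system $\mathcal F$ on $\mathit{hofib}_U(r)$, with $i\colon r^{-1}(z)\to r^{-1}(U)$ the inclusion and $j\colon r^{-1}(U)\to\mathit{hofib}_U(r)$ the natural inclusion (constant paths), the map $$i_*\colon H_*(r^{-1}(z);i^*j^*\mathcal F)\to H_*(r^{-1}(U);j^*\mathcal F)$$ is an isomorphism. **Proposition.** Assume that each $z\in Z$ has, in the subspace topology of $Z$, a basis of open neighborhoods $U$ with a deformation retraction onto $\{z\}$ which lifts to a deformation retraction of $r^{-1}(U)$ into $r^{-1}(z)$; that is, there are continuous homotopies $h_t\colon U\to U$ and $H_t\colon r^{-1}(U)\to r^{-1}(U)$, $t\in[0,1]$, with $h_0=\mathrm{id}$, $h_1\equiv z$, $H_0=\mathrm{id}$ and $r\circ H_t=h_t\circ r$ for all $t$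 (so that $H_1$ maps into $r^{-1}(z)$). If $r$ is a twisted (resp. abelian) Serre homology fibration on $Z$, then $r$ is also a twisted (resp. abelian) Leray homology fibration on $Z$. -/

import Mathlib

open CategoryTheory CategoryTheory.Limits Topology
open scoped unitInterval

universe u

noncomputable section

namespace TwistedHomology

/-! ### Local coefficient systems -/

/-- A system of local coefficients on a space `E`: a functor from the fundamental groupoid of `E`
to abelian groups. -/
abbrev LocalSystem (E : Type u) [TopologicalSpace E] : Type (u + 1) :=
  FundamentalGroupoid E ⥤ AddCommGrpCat.{u}

/-- The pullback `f^* F` of a local coefficient system along a continuous map. -/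
abbrev LocalSystem.pullback {A B : Type u} [TopologicalSpace A] [TopologicalSpace B]
    (f : C(A, B)) (F : LocalSystem B) : LocalSystem A :=
  FundamentalGroupoid.map f ⋙ F

/-- A local coefficient system is abelian if, at every base point, the monodromy around every
commutator loop is trivial. -/
def LocalSystem.IsAbelian {E : Type u} [TopologicalSpace E] (F : LocalSystem E) : Prop :=
  ∀ (x : FundamentalGroupoid E) (p q : x ⟶ x),
    F.map (p ≫ q ≫ Groupoid.inv p ≫ Groupoid.inv q) = 𝟙 (F.obj x)

/-! ### Singular homology with local coefficients -/

/-- The standard topological `n`-simplex. -/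
abbrev Simp (n : SimplexCategory) : Type := stdSimplex ℝ (Fin (n.len + 1))

/-- The initial vertex of the standard simplex. -/
abbrev v₀ (n : SimplexCategory) : Simp n := stdSimplex.vertex 0

/-- The affine map of standard simplices induced by a monotone map of vertices. -/
def simpMap {m n : SimplexCategory} (θ : m ⟶ n) : C(Simp m, Simp n) :=
  ⟨stdSimplex.map θ, stdSimplex.continuous_map θ⟩

lemma simpMap_id (n : SimplexCategory) : simpMap (𝟙 n) = ContinuousMap.id _ := by
  ext1 x
  exact stdSimplex.map_id_apply x

lemma simpMap_comp {l m n : SimplexCategory} (θ : l ⟶ m) (η : m ⟶ n) :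
    simpMap (θ ≫ η) = (simpMap η).comp (simpMap θ) := by
  ext1 x
  exact (stdSimplex.map_comp_apply θ η x).symm

instance (n : SimplexCategory) : ContractibleSpace (Simp n) :=
  (convex_stdSimplex ℝ (Fin (n.len + 1))).contractibleSpace
    ⟨_, (stdSimplex.vertex (S := ℝ) (0 : Fin (n.len + 1))).2⟩

/-- The homotopy class of paths between two points of a standard simplex. It is unique, because
the simplex is contractible. -/
def simpPath {n : SimplexCategory} (a b : Simp n) :
    (⟨a⟩ : FundamentalGroupoid (Simp n)) ⟶ ⟨b⟩ :=
  Path.Homotopic.Quotient.mk (PathConnectedSpace.somePath a b)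

lemma simpPath_unique {n : SimplexCategory} {a b : FundamentalGroupoid (Simp n)} (p q : a ⟶ b) :
    p = q :=
  Subsingleton.elim (α := Path.Homotopic.Quotient a.as b.as) p q

lemma map_comp_map {A B C : Type*} [TopologicalSpace A] [TopologicalSpace B] [TopologicalSpace C]
    (g : C(B, C)) (f : C(A, B)) {x y : FundamentalGroupoid A} (p : x ⟶ y) :
    (FundamentalGroupoid.map (g.comp f)).map p =
      (FundamentalGroupoid.map g).map ((FundamentalGroupoid.map f).map p) := by
  rcases p with ⟨p⟩
  rfl

section Chains

variable {E : Type u} [TopologicalSpace E] (F : LocalSystem E)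

/-- The group of singular `n`-chains of `E` with coefficients in `F`: the direct sum, over all
singular simplices `s : Δⁿ → E`, of the value of `F` at the initial vertex of `s`. -/
abbrev chainObj (n : SimplexCategory) : AddCommGrpCat.{u} :=
  ∐ fun s : C(Simp n, E) => F.obj ⟨s (v₀ n)⟩

/-- The inclusion of the summand of the singular simplex `s`. -/
abbrev chainIncl {n : SimplexCategory} (s : C(Simp n, E)) :
    F.obj ⟨s (v₀ n)⟩ ⟶ chainObj F n :=
  Sigma.ι (fun s' : C(Simp n, E) => F.obj ⟨s' (v₀ n)⟩) s

/-- Transport in `F` along the image under `s : Δⁿ → E` of the path from `a` to `b` in `Δⁿ`. -/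
def transport {n : SimplexCategory} (s : C(Simp n, E)) (a b : Simp n) :
    F.obj ⟨s a⟩ ⟶ F.obj ⟨s b⟩ :=
  F.map ((FundamentalGroupoid.map s).map (simpPath a b))

lemma transport_self {n : SimplexCategory} (s : C(Simp n, E)) (a : Simp n) :
    transport F s a a = 𝟙 _ := by
  unfold transport
  rw [simpPath_unique (simpPath a a) (𝟙 _)]
  exact (congrArg F.map ((FundamentalGroupoid.map s).map_id _)).trans (F.map_id _)

lemma transport_comp {n : SimplexCategory} (s : C(Simp n, E)) (a b c : Simp n) :
    transport F s a b ≫ transport F s b c = transport F s a c := by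
  unfold transport
  rw [simpPath_unique (simpPath a c) (simpPath a b ≫ simpPath b c)]
  exact ((congrArg F.map ((FundamentalGroupoid.map s).map_comp _ _)).trans
    (F.map_comp _ _)).symm

lemma transport_precomp {m n : SimplexCategory} (s : C(Simp n, E)) (f : C(Simp m, Simp n))
    (a b : Simp m) : transport F (s.comp f) a b = transport F s (f a) (f b) := by
  have h : (FundamentalGroupoid.map f).map (simpPath a b) = simpPath (f a) (f b) :=
    simpPath_unique _ _
  unfold transport
  rw [← h]
  exact congrArg F.map (map_comp_map s f (simpPath a b))

/-- The simplicial operator induced by `θ`: the summand of `s` is sent to the summand of `s ∘ θ`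
by transport along the image under `s` of the path from the initial vertex to the
`θ`-image of the initial vertex. -/
def chainMap {m n : SimplexCategory} (θ : m ⟶ n) : chainObj F n ⟶ chainObj F m :=
  Sigma.desc fun s : C(Simp n, E) =>
    transport F s (v₀ n) (simpMap θ (v₀ m)) ≫ chainIncl F (s.comp (simpMap θ))

lemma chainIncl_chainMap {m n : SimplexCategory} (θ : m ⟶ n) (s : C(Simp n, E)) :
    chainIncl F s ≫ chainMap F θ =
      transport F s (v₀ n) (simpMap θ (v₀ m)) ≫ chainIncl F (s.comp (simpMap θ)) :=
  Sigma.ι_desc _ _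

lemma transport_chainIncl_congr {m n : SimplexCategory} (s : C(Simp n, E))
    {f g : C(Simp m, Simp n)} (h : f = g) :
    transport F s (v₀ n) (f (v₀ m)) ≫ chainIncl F (s.comp f) =
      transport F s (v₀ n) (g (v₀ m)) ≫ chainIncl F (s.comp g) := by
  subst h
  rfl

/-- The simplicial abelian group of singular chains of `E` with coefficients in `F`. -/
def chains : SimplicialObject AddCommGrpCat.{u} where
  obj n := chainObj F n.unop
  map θ := chainMap F θ.unop
  map_id n := by
    apply Sigma.hom_ext
    intro s
    refine (chainIncl_chainMap F _ s).trans ?_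
    refine (transport_chainIncl_congr F s (simpMap_id n.unop)).trans ?_
    refine Eq.trans ?_ (Category.comp_id _).symm
    refine (congrArg (· ≫ chainIncl F s) (transport_self F s (v₀ n.unop))).trans ?_
    exact Category.id_comp _
  map_comp {l m n} θ η := by
    apply Sigma.hom_ext
    intro s
    refine (chainIncl_chainMap F _ s).trans ?_
    refine (transport_chainIncl_congr F s (simpMap_comp η.unop θ.unop)).trans ?_
    refine Eq.trans ?_ (Category.assoc (chainIncl F s) _ _)
    rw [chainIncl_chainMap, Category.assoc, chainIncl_chainMap, transport_precomp,
      ← Category.assoc, transport_comp]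
    rfl

/-- The singular chain complex of `E` with coefficients in `F`, whose differential is the
alternating sum of the face operators. -/
def chainComplex : ChainComplex AddCommGrpCat.{u} ℕ :=
  AlgebraicTopology.AlternatingFaceMapComplex.obj (chains F)

/-- The singular homology group `H_n(E; F)` with local coefficients. -/
def homology (n : ℕ) : AddCommGrpCat.{u} := (chainComplex F).homology n

end Chains

section Maps

variable {A B : Type u} [TopologicalSpace A] [TopologicalSpace B] (f : C(A, B))
  (F : LocalSystem B)

/-- The map on chains induced by a continuous map `f : A → B`: the summand of `s` is sent
identically to the summand of `f ∘ s`. -/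
def pushChain (n : SimplexCategory) : chainObj (F.pullback f) n ⟶ chainObj F n :=
  Sigma.desc fun s : C(Simp n, A) => chainIncl F (f.comp s)

lemma chainIncl_pushChain {n : SimplexCategory} (s : C(Simp n, A)) :
    chainIncl (F.pullback f) s ≫ pushChain f F n = chainIncl F (f.comp s) :=
  Sigma.ι_desc _ _

lemma transport_pullback {n : SimplexCategory} (s : C(Simp n, A)) (a b : Simp n) :
    transport (F.pullback f) s a b = transport F (f.comp s) a b := by
  exact congrArg F.map (map_comp_map f s (simpPath a b)).symm

/-- The simplicial map on singular chains induced by `f`. -/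
def pushChains : chains (F.pullback f) ⟶ chains F where
  app n := pushChain f F n.unop
  naturality n m θ := by
    apply Sigma.hom_ext
    intro s
    change chainIncl (F.pullback f) s ≫ chainMap (F.pullback f) θ.unop ≫ pushChain f F m.unop =
      chainIncl (F.pullback f) s ≫ pushChain f F n.unop ≫ chainMap F θ.unop
    rw [← Category.assoc, ← Category.assoc, chainIncl_chainMap, Category.assoc,
      chainIncl_pushChain, transport_pullback]
    refine Eq.trans ?_ (congrArg (· ≫ chainMap F θ.unop) (chainIncl_pushChain f F s)).symm
    exact (chainIncl_chainMap F θ.unop (f.comp s)).symm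

/-- The induced map `f_* : H_n(A; f^* F) → H_n(B; F)`. -/
def homologyMap (n : ℕ) : homology (F.pullback f) n ⟶ homology F n :=
  HomologicalComplex.homologyMap
    (AlgebraicTopology.AlternatingFaceMapComplex.map (pushChains f F)) n

/-- `f` induces an isomorphism `H_*(A; f^* F) → H_*(B; F)`. -/
def InducesHomologyIso : Prop := ∀ n : ℕ, IsIso (homologyMap f F n)

end Maps

/-! ### Homotopy fibers -/

section HomotopyFibers

variable {X Y : Type u} [TopologicalSpace X] [TopologicalSpace Y]

/-- For `U ⊆ Z ⊆ X`, the space `hofib_U(r|_Z)`, i.e. the homotopy limit of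
`U → Z ← r⁻¹(Z)`: pairs of a path `γ` in `Z` and a point `y` of `Y` such that `γ` starts in `U`
and ends at `r y`. The topology is the one induced by the compact-open topology on paths. -/
abbrev Hofib (r : C(Y, X)) (Z U : Set X) : Type u :=
  {p : C(I, X) × Y // (∀ t, p.1 t ∈ Z) ∧ p.1 0 ∈ U ∧ p.1 1 = r p.2}

/-- The natural inclusion `r⁻¹(U) → hofib_U(r|_Z)`, given by constant paths. -/
def toHofib (r : C(Y, X)) {Z U : Set X} (h : U ⊆ Z) : C(r ⁻¹' U, Hofib r Z U) where
  toFun y := ⟨(ContinuousMap.const I (r y), y), fun _ => h y.2, y.2, rfl⟩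
  continuous_toFun := by
    refine Continuous.subtype_mk (Continuous.prodMk ?_ continuous_subtype_val) _
    exact ContinuousMap.continuous_const'.comp (r.continuous.comp continuous_subtype_val)

/-- The natural inclusion `hofib_U(r|_Z) → hofib_U(r|_{Z'})` for `Z ⊆ Z'`. -/
def hofibIncl (r : C(Y, X)) {Z Z' : Set X} (h : Z ⊆ Z') (U : Set X) :
    C(Hofib r Z U, Hofib r Z' U) where
  toFun p := ⟨p.1, fun t => h (p.2.1 t), p.2.2⟩
  continuous_toFun := continuous_subtype_val.subtype_mk _

/-- The inclusion `r⁻¹(V) → r⁻¹(U)` for `V ⊆ U`. -/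
def preimageIncl (r : C(Y, X)) {V U : Set X} (h : V ⊆ U) : C(r ⁻¹' V, r ⁻¹' U) where
  toFun y := ⟨y, h y.2⟩
  continuous_toFun := continuous_subtype_val.subtype_mk _

/-! ### Serre and Leray homology fibrations -/

/-- The inclusion `r⁻¹(z) → hofib_z(r|_Z)` induces an isomorphism on homology with coefficients
pulled back from the local system `F` on `hofib_z(r)`. -/
def SerreCondition (r : C(Y, X)) (Z : Set X) (z : Z) (F : LocalSystem (Hofib r Set.univ {z.1})) :
    Prop :=
  InducesHomologyIso (toHofib r (Set.singleton_subset_iff.2 z.2))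
    (F.pullback (hofibIncl r (Set.subset_univ Z) {z.1}))

/-- `r` is a twisted Serre homology fibration on `Z`. -/
def IsTwistedSerreOn (r : C(Y, X)) (Z : Set X) : Prop :=
  ∀ (z : Z) (F : LocalSystem (Hofib r Set.univ {z.1})), SerreCondition r Z z F

/-- `r` is an abelian Serre homology fibration on `Z`. -/
def IsAbelianSerreOn (r : C(Y, X)) (Z : Set X) : Prop :=
  ∀ (z : Z) (F : LocalSystem (Hofib r Set.univ {z.1})), F.IsAbelian → SerreCondition r Z z F

/-- For `z ∈ U`, the inclusion `r⁻¹(z) → r⁻¹(U)` induces an isomorphism on homology with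
coefficients pulled back from the local system `F` on `hofib_U(r)`. -/
def LerayCondition (r : C(Y, X)) {U : Set X} {z : X} (hz : z ∈ U)
    (F : LocalSystem (Hofib r Set.univ U)) : Prop :=
  InducesHomologyIso (preimageIncl r (Set.singleton_subset_iff.2 hz))
    (F.pullback (toHofib r (Set.subset_univ U)))

/-- `r` is a twisted Leray homology fibration on `Z`: the topology of `Z` has a basis `𝓤` of
contractible sets (in particular `Z` is locally contractible) such that the Leray condition holds
for all `z ∈ U ∈ 𝓤` and all local systems on `hofib_U(r)`. -/
def IsTwistedLerayOn (r : C(Y, X)) (Z : Set X) : Prop :=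
  ∃ 𝓤 : Set (Set Z), TopologicalSpace.IsTopologicalBasis 𝓤 ∧
    (∀ U ∈ 𝓤, ContractibleSpace U) ∧
    ∀ U ∈ 𝓤, ∀ (z : X) (hz : z ∈ Subtype.val '' U)
      (F : LocalSystem (Hofib r Set.univ (Subtype.val '' U))), LerayCondition r hz F

/-- `r` is an abelian Leray homology fibration on `Z`. -/
def IsAbelianLerayOn (r : C(Y, X)) (Z : Set X) : Prop :=
  ∃ 𝓤 : Set (Set Z), TopologicalSpace.IsTopologicalBasis 𝓤 ∧
    (∀ U ∈ 𝓤, ContractibleSpace U) ∧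
    ∀ U ∈ 𝓤, ∀ (z : X) (hz : z ∈ Subtype.val '' U)
      (F : LocalSystem (Hofib r Set.univ (Subtype.val '' U))), F.IsAbelian → LerayCondition r hz F

/-- There is a deformation retraction `h` of `U` onto `{z}` which lifts along `r` to a deformation
`H` of `r⁻¹(U)` into `r⁻¹(z)`. That `H` ends in `r⁻¹(z)` is a consequence of the last two
clauses. Neither `h` nor `H` has to be stationary on `{z}`, respectively on `r⁻¹(z)`; deformation
retractions which are so are a special case. -/
def HasLiftedDeformation (r : C(Y, X)) (U : Set X) (z : X) : Prop :=
  ∃ (h : C(I × U, U)) (H : C(I × (r ⁻¹' U), r ⁻¹' U)),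
    (∀ u, h (0, u) = u) ∧ (∀ u, (h (1, u) : X) = z) ∧ (∀ y, H (0, y) = y) ∧
      ∀ (t : I) (y : r ⁻¹' U), r (H (t, y)) = h (t, ⟨r y, y.2⟩)

end HomotopyFibers

end TwistedHomology

end

/-!
The proof compares, for `z` in a contractible set `V ⊆ Z`, the two ways around the square

       r⁻¹(z)     ⟶     r⁻¹(V)
         |                 |
         v                 v
    hofib_z(r|_Z) ⟶ hofib_V(r|_Z)

with coefficients restricted from `hofib_V(r)`. The left map is a homology isomorphism by the Serre
condition, because the coefficients on `hofib_z(r|_Z)` come from `hofib_z(r)`. The bottom map is a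
homotopy equivalence because `V` contracts in itself: prepending the contraction paths to the paths
in the homotopy fiber is a homotopy inverse (`inducesHomologyIso_hofibBaseIncl`). So the composite
through `r⁻¹(V)` is an isomorphism for every `z ∈ V`.

At the center `c` of the contraction, the lifted deformation of `r⁻¹(V)` shows that the top map
is surjective on homology. It need not be a homotopy equivalence, since the deformation may move
the points of `r⁻¹(c)`; but injectivity follows from the composite. Hence the right map, which does
not depend on `z`, is an isomorphism, and then so is the top map for every other `z ∈ V`
(`lerayCondition_of_serreCondition`). Abelian coefficients stay abelian under pullback, so the two
cases have the same proof. The required basis of `Z` consists of all open sets with a lifted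
deformation to one of their points.

What remains is homotopy invariance of homology with local coefficients
(`inducesHomologyIso_slice_iff`). A homotopy `K` yields prism operators `s ↦ K ∘ (α, s)`, for
`α : [n] ⟶ [1]`, with coefficients transported along the tracks of `K`. All paths involved are images
of paths in `[0, 1] × Δⁿ`, which is simply connected, so that identities between transports hold
automatically (`transportIncl`).
-/

noncomputable section

namespace TwistedHomology

open Simplicial Opposite

/-! ### Simplicial homotopies indexed by the simplices of the interval -/

section SimplicialHomotopy

variable {C : Type*} [Category C] {X Y : SimplicialObject C} {f g : X ⟶ Y}

/-- A simplicial homotopy given in "cylinder" form, by maps `κ α : Xₙ ⟶ Yₙ` for all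
`α : [n] ⟶ [1]`, natural in `[n]`, yields a combinatorial one. The `i`-th prism operator is
`κ` applied to the `i`-th degeneracy and to the `α : [n + 1] ⟶ [1]` with `i + 1` zeros. The map
`f` is the value at the constant `0`, which is `toMk₁ (Fin.last _)`, and `g` the value at the
constant `1`, which is `toMk₁ 0`. -/
def simplicialHomotopyOfCylinder
    (κ : ∀ {n : SimplexCategory}, (n ⟶ ⦋1⦌) → (X.obj (op n) ⟶ Y.obj (op n)))
    (nat : ∀ {m n : SimplexCategory} (θ : m ⟶ n) (α : n ⟶ ⦋1⦌),
      κ α ≫ Y.map θ.op = X.map θ.op ≫ κ (θ ≫ α))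
    (hf : ∀ n : ℕ, κ (SimplexCategory.toMk₁ (Fin.last (n + 1))) = f.app (op ⦋n⦌))
    (hg : ∀ n : ℕ, κ (SimplexCategory.toMk₁ (0 : Fin (n + 2))) = g.app (op ⦋n⦌)) :
    SimplicialObject.Homotopy f g := by
  -- Faces and degeneracies of a prism operator are computed in the simplex category.
  have key : ∀ {n m : ℕ} (i : Fin (n + 1)) (θ : ⦋m⦌ ⟶ ⦋n + 1⦌) (φ : ⦋m⦌ ⟶ ⦋n⦌) (α : ⦋m⦌ ⟶ ⦋1⦌),
      θ ≫ SimplexCategory.σ i = φ → θ ≫ SimplexCategory.toMk₁ i.succ.castSucc = α →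
      (X.σ i ≫ κ (SimplexCategory.toMk₁ i.succ.castSucc)) ≫ Y.map θ.op = X.map φ.op ≫ κ α := by
    rintro n m i θ _ _ rfl rfl
    rw [Category.assoc, nat, SimplicialObject.σ, ← Category.assoc, ← X.map_comp, op_comp]
  have key' : ∀ {n m k : ℕ} (θ : ⦋m⦌ ⟶ ⦋n⦌) (φ : ⦋k⦌ ⟶ ⦋m⦌) (α : ⦋k⦌ ⟶ ⦋1⦌),
      X.map θ.op ≫ X.map φ.op ≫ κ α = X.map (φ ≫ θ).op ≫ κ α := by
    intro n m k θ φ α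
    rw [← Category.assoc, ← X.map_comp, op_comp]
  refine
    { h := fun {n} i => X.σ i ≫ κ (SimplexCategory.toMk₁ i.succ.castSucc)
      h_zero_comp_δ_zero := fun n => ?_
      h_last_comp_δ_last := fun n => ?_
      h_succ_comp_δ_castSucc_of_lt := fun {n} i j hij => ?_
      h_succ_comp_δ_castSucc_succ := fun {n} j => ?_
      h_castSucc_comp_δ_succ_of_lt := fun {n} i j hij => ?_
      h_comp_σ_castSucc_of_le := fun {n} i j hij => ?_
      h_comp_σ_succ_of_lt := fun {n} i j hij => ?_ }
  · refine (key 0 (SimplexCategory.δ 0) (𝟙 _) (SimplexCategory.toMk₁ 0)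
      SimplexCategory.δ_comp_σ_self (SimplexCategory.δ_comp_toMk₁_of_lt _ _ (by simp))).trans ?_
    rw [op_id, X.map_id, Category.id_comp, hg]
  · refine (key (Fin.last n) (SimplexCategory.δ (Fin.last (n + 1))) (𝟙 _)
      (SimplexCategory.toMk₁ (Fin.last (n + 1))) SimplexCategory.δ_comp_σ_succ
      (SimplexCategory.δ_comp_toMk₁_of_le _ _ le_rfl)).trans ?_
    rw [op_id, X.map_id, Category.id_comp, hf]
  · refine (key j.succ (SimplexCategory.δ i.castSucc) _ (SimplexCategory.toMk₁ j.succ.castSucc)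
      (SimplexCategory.δ_comp_σ_of_le hij)
      ((SimplexCategory.δ_comp_toMk₁_of_lt _ _ ?_).trans ?_)).trans (key' _ _ _).symm
    · simp only [Fin.lt_def, Fin.le_def, Fin.val_castSucc, Fin.val_succ] at hij ⊢
      omega
    · rfl
  · refine (key j.succ (SimplexCategory.δ j.castSucc.succ) (𝟙 _)
      (SimplexCategory.toMk₁ j.succ.castSucc) SimplexCategory.δ_comp_σ_self
      (SimplexCategory.δ_comp_toMk₁_of_lt _ _ ?_)).trans
      (key j.castSucc (SimplexCategory.δ j.castSucc.succ) (𝟙 _)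
      (SimplexCategory.toMk₁ j.succ.castSucc) SimplexCategory.δ_comp_σ_succ
      (SimplexCategory.δ_comp_toMk₁_of_le _ _ ?_)).symm
    · simp [Fin.lt_def]
    · simp 
  · refine (key j.castSucc (SimplexCategory.δ i.succ) _ (SimplexCategory.toMk₁ j.succ.castSucc)
      (SimplexCategory.δ_comp_σ_of_gt hij)
      (SimplexCategory.δ_comp_toMk₁_of_le _ _ ?_)).trans (key' _ _ _).symm
    simp only [Fin.lt_def, Fin.le_def, Fin.val_castSucc, Fin.val_succ] at hij ⊢
    omega
  · refine (key j (SimplexCategory.σ i.castSucc) _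
      (SimplexCategory.toMk₁ j.succ.succ.castSucc) (SimplexCategory.σ_comp_σ hij)
      (SimplexCategory.σ_comp_toMk₁_of_lt _ _ ?_)).trans (key' _ _ _).symm
    simp only [Fin.lt_def, Fin.le_def, Fin.val_castSucc, Fin.val_succ] at hij ⊢
    omega
  · refine (key j (SimplexCategory.σ i.succ) _
      (SimplexCategory.toMk₁ j.castSucc.succ.castSucc) (SimplexCategory.σ_comp_σ hij).symm
      (SimplexCategory.σ_comp_toMk₁_of_le _ _ ?_)).trans (key' _ _ _).symm
    simp only [Fin.le_def, Fin.val_castSucc, Fin.val_succ] at hij ⊢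
    omega

end SimplicialHomotopy

/-! ### Functoriality in the coefficients and in the space -/

section Coefficients

variable {E : Type u} [TopologicalSpace E] {F G K : LocalSystem E}

/-- The map on `n`-chains induced by a morphism of local coefficient systems. -/
def coeffChain (φ : F ⟶ G) (n : SimplexCategory) : chainObj F n ⟶ chainObj G n :=
  Sigma.desc fun s : C(Simp n, E) => φ.app ⟨s (v₀ n)⟩ ≫ chainIncl G s

lemma chainIncl_coeffChain (φ : F ⟶ G) {n : SimplexCategory} (s : C(Simp n, E)) :
    chainIncl F s ≫ coeffChain φ n = φ.app ⟨s (v₀ n)⟩ ≫ chainIncl G s :=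
  Sigma.ι_desc _ _

lemma transport_naturality (φ : F ⟶ G) {n : SimplexCategory} (s : C(Simp n, E)) (a b : Simp n) :
    transport F s a b ≫ φ.app ⟨s b⟩ = φ.app ⟨s a⟩ ≫ transport G s a b :=
  φ.naturality _

/-- The simplicial map on singular chains induced by a morphism of local coefficient systems. -/
def coeffChains (φ : F ⟶ G) : chains F ⟶ chains G where
  app n := coeffChain φ n.unop
  naturality n m θ := by
    apply Sigma.hom_ext
    intro s
    change chainIncl F s ≫ chainMap F θ.unop ≫ coeffChain φ m.unop =
      chainIncl F s ≫ coeffChain φ n.unop ≫ chainMap G θ.unop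
    rw [← Category.assoc, ← Category.assoc, chainIncl_chainMap, chainIncl_coeffChain,
      Category.assoc, Category.assoc, chainIncl_coeffChain, chainIncl_chainMap]
    refine (Category.assoc _ _ _).symm.trans (Eq.trans ?_ (Category.assoc _ _ _))
    exact congrArg (· ≫ chainIncl G (s.comp (simpMap θ.unop))) (transport_naturality φ s _ _)

lemma chains_hom_ext {X : SimplicialObject AddCommGrpCat.{u}} {f g : chains F ⟶ X}
    (h : ∀ (n : SimplexCategory) (s : C(Simp n, E)),
      chainIncl F s ≫ f.app (op n) = chainIncl F s ≫ g.app (op n)) : f = g :=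
  NatTrans.ext (funext fun n => Sigma.hom_ext _ _ (h n.unop))

lemma coeffChains_id : coeffChains (𝟙 F) = 𝟙 (chains F) := by
  refine chains_hom_ext fun n s => ?_
  exact (chainIncl_coeffChain (𝟙 F) s).trans ((Category.id_comp _).trans (Category.comp_id _).symm)

lemma coeffChains_comp (φ : F ⟶ G) (ψ : G ⟶ K) :
    coeffChains (φ ≫ ψ) = coeffChains φ ≫ coeffChains ψ := by
  refine chains_hom_ext fun n s => ?_
  change chainIncl F s ≫ coeffChain (φ ≫ ψ) n =
    chainIncl F s ≫ coeffChain φ n ≫ coeffChain ψ n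
  rw [chainIncl_coeffChain, ← Category.assoc, chainIncl_coeffChain, Category.assoc,
    chainIncl_coeffChain, NatTrans.comp_app, Category.assoc]

instance (φ : F ⟶ G) [IsIso φ] : IsIso (coeffChains φ) :=
  ⟨coeffChains (inv φ), by rw [← coeffChains_comp, IsIso.hom_inv_id, coeffChains_id],
    by rw [← coeffChains_comp, IsIso.inv_hom_id, coeffChains_id]⟩

end Coefficients

/-- The `n`-th homology of a simplicial abelian group, as a functor. Applied to singular chains
it is `homology`, definitionally. -/
abbrev simplicialHomology (n : ℕ) : SimplicialObject AddCommGrpCat.{u} ⥤ AddCommGrpCat.{u} :=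
  AlgebraicTopology.alternatingFaceMapComplex AddCommGrpCat.{u} ⋙
    HomologicalComplex.homologyFunctor _ _ n

section Functoriality

variable {A B D : Type u} [TopologicalSpace A] [TopologicalSpace B] [TopologicalSpace D]

lemma inducesHomologyIso_iff (f : C(A, B)) (F : LocalSystem B) :
    InducesHomologyIso f F ↔ ∀ n, IsIso ((simplicialHomology n).map (pushChains f F)) :=
  Iff.rfl

lemma pushChains_naturality (f : C(A, B)) {F G : LocalSystem B} (φ : F ⟶ G) :
    pushChains f F ≫ coeffChains φ =
      coeffChains (Functor.whiskerLeft (FundamentalGroupoid.map f) φ) ≫ pushChains f G := by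
  refine chains_hom_ext fun n s => ?_
  change chainIncl (F.pullback f) s ≫ pushChain f F n ≫ coeffChain φ n =
    chainIncl (F.pullback f) s ≫
      coeffChain (Functor.whiskerLeft (FundamentalGroupoid.map f) φ) n ≫ pushChain f G n
  rw [← Category.assoc, ← Category.assoc, chainIncl_pushChain, chainIncl_coeffChain,
    Category.assoc, chainIncl_pushChain]
  exact chainIncl_coeffChain φ (f.comp s)

/-- Pulling back along a composition is pulling back twice. The components of this isomorphism
are identities. -/
def pullbackComp (g : C(B, D)) (f : C(A, B)) (F : LocalSystem D) :
    (F.pullback g).pullback f ≅ F.pullback (g.comp f) :=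
  NatIso.ofComponents (fun _ => Iso.refl _) fun p => by
    refine (Category.comp_id _).trans (Eq.trans ?_ (Category.id_comp _).symm)
    exact congrArg F.map (map_comp_map g f p).symm

lemma pushChains_comp (g : C(B, D)) (f : C(A, B)) (F : LocalSystem D) :
    pushChains f (F.pullback g) ≫ pushChains g F =
      coeffChains (pullbackComp g f F).hom ≫ pushChains (g.comp f) F := by
  refine chains_hom_ext fun n s => ?_
  change chainIncl ((F.pullback g).pullback f) s ≫
      pushChain f (F.pullback g) n ≫ pushChain g F n =
    chainIncl ((F.pullback g).pullback f) s ≫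
      coeffChain (pullbackComp g f F).hom n ≫ pushChain (g.comp f) F n
  rw [← Category.assoc, ← Category.assoc, chainIncl_pushChain, chainIncl_coeffChain,
    Category.assoc, chainIncl_pushChain]
  exact (chainIncl_pushChain g F (f.comp s)).trans (Category.id_comp _).symm

lemma InducesHomologyIso.congr {f : C(A, B)} {F G : LocalSystem B} (e : F ≅ G)
    (h : InducesHomologyIso f F) : InducesHomologyIso f G := by
  rw [inducesHomologyIso_iff] at h ⊢
  intro n
  have := h n
  have key := congrArg (simplicialHomology n).map (pushChains_naturality f e.hom)
  rw [Functor.map_comp, Functor.map_comp] at key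
  have hcomp : IsIso ((simplicialHomology n).map
      (coeffChains (Functor.whiskerLeft (FundamentalGroupoid.map f) e.hom)) ≫
        (simplicialHomology n).map (pushChains f G)) := key ▸ inferInstance
  exact (isIso_comp_left_iff _ _).1 hcomp

lemma inducesHomologyIso_comp_iff (g : C(B, D)) (f : C(A, B)) (F : LocalSystem D) :
    InducesHomologyIso (g.comp f) F ↔
      ∀ n, IsIso (homologyMap f (F.pullback g) n ≫ homologyMap g F n) := by
  rw [inducesHomologyIso_iff]
  refine forall_congr' fun n => ?_
  have key := congrArg (simplicialHomology n).map (pushChains_comp g f F)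
  rw [Functor.map_comp, Functor.map_comp] at key
  refine Iff.trans ?_ (Iff.of_eq (congrArg (fun φ => IsIso φ) key)).symm
  exact (isIso_comp_left_iff _ _).symm

lemma inducesHomologyIso_id (F : LocalSystem A) : InducesHomologyIso (ContinuousMap.id A) F := by
  rw [inducesHomologyIso_iff]
  intro n
  -- Up to a coefficient isomorphism with identity components, the map is the identity.
  let e : F.pullback (ContinuousMap.id A) ≅ F :=
    NatIso.ofComponents (fun _ => Iso.refl _) fun p => by
      refine (Category.comp_id _).trans (Eq.trans ?_ (Category.id_comp _).symm)
      obtain ⟨p⟩ := p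
      rfl
  have : pushChains (ContinuousMap.id A) F = coeffChains e.hom := by
    refine chains_hom_ext fun n s => ?_
    refine (chainIncl_pushChain (ContinuousMap.id A) F s).trans
      (Eq.trans ?_ (chainIncl_coeffChain e.hom s).symm)
    exact (Category.id_comp _).symm
  rw [this]
  infer_instance

end Functoriality

/-! ### Homotopy invariance -/

section TransportAlong

variable {E : Type u} [TopologicalSpace E] (F : LocalSystem E)
  {P Q : Type} [TopologicalSpace P] [SimplyConnectedSpace P] [TopologicalSpace Q]
  [SimplyConnectedSpace Q]

/-- Transport in `F` along the image under `S : P → E` of the unique homotopy class of paths from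
`a` to `b` in the simply connected space `P`. For `P` a simplex this is `transport`. -/
def transportAlong (S : C(P, E)) (a b : P) : F.obj ⟨S a⟩ ⟶ F.obj ⟨S b⟩ :=
  F.map ((FundamentalGroupoid.map S).map
    (X := ⟨a⟩) (Y := ⟨b⟩) (Path.Homotopic.Quotient.mk (PathConnectedSpace.somePath a b)))

lemma transportAlong_eq (S : C(P, E)) {a b : P}
    (p : (⟨a⟩ : FundamentalGroupoid P) ⟶ ⟨b⟩) :
    transportAlong F S a b = F.map ((FundamentalGroupoid.map S).map p) := by
  unfold transportAlong
  congr 2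
  exact Subsingleton.elim (α := Path.Homotopic.Quotient a b) _ _

lemma transportAlong_self (S : C(P, E)) (a : P) : transportAlong F S a a = 𝟙 _ := by
  rw [transportAlong_eq F S (𝟙 _)]
  exact (congrArg F.map ((FundamentalGroupoid.map S).map_id _)).trans (F.map_id _)

lemma transportAlong_comp (S : C(P, E)) (a b c : P) :
    transportAlong F S a b ≫ transportAlong F S b c = transportAlong F S a c := by
  let p (x y : P) : (⟨x⟩ : FundamentalGroupoid P) ⟶ ⟨y⟩ :=
    Path.Homotopic.Quotient.mk (PathConnectedSpace.somePath x y)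
  rw [transportAlong_eq F S (p a b ≫ p b c)]
  exact ((congrArg F.map ((FundamentalGroupoid.map S).map_comp _ _)).trans
    (F.map_comp _ _)).symm

lemma transportAlong_precomp (S : C(P, E)) (w : C(Q, P)) (a b : Q) :
    transportAlong F (S.comp w) a b = transportAlong F S (w a) (w b) := by
  rw [transportAlong_eq F S ((FundamentalGroupoid.map w).map
    (X := ⟨a⟩) (Y := ⟨b⟩) (Path.Homotopic.Quotient.mk (PathConnectedSpace.somePath a b)))]
  exact congrArg F.map (map_comp_map S w _)

/-- The summand attached to a simplex `S ∘ w` parametrized by a simply connected space: transport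
along `S` from `a` to the image of the initial vertex under `w`, followed by the inclusion of the
summand of `S ∘ w`. Equalities between simplices of `E` become equalities between maps into `P`,
with no change of the coefficient group at `a`. -/
def transportIncl (S : C(P, E)) (a : P) {n : SimplexCategory} (w : C(Simp n, P)) :
    F.obj ⟨S a⟩ ⟶ chainObj F n :=
  transportAlong F S a (w (v₀ n)) ≫ chainIncl F (S.comp w)

lemma transportAlong_transportIncl (S : C(P, E)) (a b : P) {n : SimplexCategory}
    (w : C(Simp n, P)) :
    transportAlong F S a b ≫ transportIncl F S b w = transportIncl F S a w := by
  unfold transportIncl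
  rw [← Category.assoc, transportAlong_comp]

lemma transportIncl_precomp (S : C(P, E)) (u : C(Q, P)) (a : Q) {n : SimplexCategory}
    (w : C(Simp n, Q)) :
    transportIncl F (S.comp u) a w = transportIncl F S (u a) (u.comp w) := by
  unfold transportIncl
  rw [transportAlong_precomp]
  rfl

lemma transportIncl_self (S : C(P, E)) {n : SimplexCategory} (w : C(Simp n, P)) :
    transportIncl F S (w (v₀ n)) w = chainIncl F (S.comp w) := by
  unfold transportIncl
  rw [transportAlong_self]
  exact Category.id_comp _

lemma transportIncl_chainMap (S : C(P, E)) (a : P) {m n : SimplexCategory} (θ : m ⟶ n)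
    (w : C(Simp n, P)) :
    transportIncl F S a w ≫ chainMap F θ = transportIncl F S a (w.comp (simpMap θ)) := by
  have h : transport F (S.comp w) (v₀ n) (simpMap θ (v₀ m)) =
      transportAlong F S (w (v₀ n)) (w (simpMap θ (v₀ m))) := transportAlong_precomp F S w _ _
  unfold transportIncl
  rw [Category.assoc, chainIncl_chainMap, h, ← Category.assoc]
  exact congrArg (· ≫ chainIncl F ((S.comp w).comp (simpMap θ))) (transportAlong_comp F S _ _ _)

end TransportAlong

instance : ContractibleSpace I := (convex_Icc (0 : ℝ) 1).contractibleSpace ⟨0, by simp⟩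

/-- The map `|Δⁿ| → [0, 1]` realizing a simplex `[n] ⟶ [1]` of the simplicial interval. -/
def intervalMap {n : SimplexCategory} (α : n ⟶ ⦋1⦌) : C(Simp n, I) :=
  ContinuousMap.comp ⟨_, stdSimplexHomeomorphUnitInterval.continuous⟩ (simpMap α)

lemma intervalMap_comp {m n : SimplexCategory} (θ : m ⟶ n) (α : n ⟶ ⦋1⦌) :
    intervalMap (θ ≫ α) = (intervalMap α).comp (simpMap θ) := by
  unfold intervalMap
  rw [simpMap_comp]
  rfl

lemma intervalMap_apply {n : SimplexCategory} (α : n ⟶ ⦋1⦌) (x : Simp n) :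
    (intervalMap α x : ℝ) = ∑ i with α i = (1 : Fin 2), x i := by
  change FunOnFinite.linearMap ℝ ℝ _ _ (1 : Fin 2) = _
  rw [FunOnFinite.linearMap_apply_apply]

lemma intervalMap_last (n : ℕ) (x : Simp ⦋n⦌) :
    intervalMap (SimplexCategory.toMk₁ (Fin.last (n + 1))) x = 0 := by
  apply Subtype.ext
  rw [intervalMap_apply]
  refine Finset.sum_eq_zero fun i hi => ?_
  have := (Finset.mem_filter.1 hi).2
  rw [SimplexCategory.toMk₁_of_castSucc_lt _ _ (Fin.castSucc_lt_last _)] at this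
  exact absurd this (by decide)

lemma intervalMap_zero (n : ℕ) (x : Simp ⦋n⦌) :
    intervalMap (SimplexCategory.toMk₁ (0 : Fin (n + 2))) x = 1 := by
  apply Subtype.ext
  rw [intervalMap_apply, Finset.filter_true_of_mem]
  · exact x.2.2
  · exact fun i _ => SimplexCategory.toMk₁_of_le_castSucc _ _ (Fin.zero_le _)

section Homotopy

variable {A B : Type u} [TopologicalSpace A] [TopologicalSpace B]

/-- The slice at time `t` of a homotopy `K`. -/
def slice (K : C(I × A, B)) (t : I) : C(A, B) :=
  K.comp ((ContinuousMap.const A t).prodMk (ContinuousMap.id A))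

/-- The product of the interval with a singular simplex, composed with a homotopy. -/
def simplexCylinder (K : C(I × A, B)) {n : SimplexCategory} (s : C(Simp n, A)) :
    C(I × Simp n, B) :=
  K.comp ((ContinuousMap.id I).prodMap s)

/-- The slice at time `t` in the cylinder on a simplex. -/
def cylinderSlice (n : SimplexCategory) (t : I) : C(Simp n, I × Simp n) :=
  (ContinuousMap.const _ t).prodMk (ContinuousMap.id _)

/-- The homotopy `K`, viewed as a homotopy between its two end slices. -/
def sliceHomotopy (K : C(I × A, B)) : (slice K 0).Homotopy (slice K 1) where
  toContinuousMap := K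
  map_zero_left _ := rfl
  map_one_left _ := rfl

/-- Transport in `F` along the tracks of a homotopy. -/
def trackTransport (K : C(I × A, B)) (F : LocalSystem B) :
    F.pullback (slice K 0) ⟶ F.pullback (slice K 1) :=
  Functor.whiskerRight (FundamentalGroupoidFunctor.homotopicMapsNatIso (sliceHomotopy K)) F

instance (K : C(I × A, B)) (F : LocalSystem B) : IsIso (trackTransport K F) := by
  unfold trackTransport
  infer_instance

lemma trackTransport_app (K : C(I × A, B)) (F : LocalSystem B) {n : SimplexCategory}
    (s : C(Simp n, A)) (a : Simp n) :
    (trackTransport K F).app ⟨s a⟩ = transportAlong F (simplexCylinder K s) (0, a) (1, a) := by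
  let p : Path ((0, a) : I × Simp n) (1, a) :=
    { toFun := fun t => (t, a)
      continuous_toFun := by fun_prop
      source' := rfl
      target' := rfl }
  exact (transportAlong_eq F (simplexCylinder K s) (Path.Homotopic.Quotient.mk p)).symm

/-- The prism on chains attached to a homotopy: for `α : [n] ⟶ [1]`, the summand of `s` is sent
to the summand of `K ∘ (α, s)`. -/
def prism (K : C(I × A, B)) (F : LocalSystem B) {n : SimplexCategory} (α : n ⟶ ⦋1⦌) :
    chainObj (F.pullback (slice K 0)) n ⟶ chainObj F n :=
  Sigma.desc fun s : C(Simp n, A) =>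
    transportIncl F (simplexCylinder K s) (0, v₀ n)
      ((intervalMap α).prodMk (ContinuousMap.id _))

lemma chainIncl_prism (K : C(I × A, B)) (F : LocalSystem B) {n : SimplexCategory} (α : n ⟶ ⦋1⦌)
    (s : C(Simp n, A)) :
    chainIncl (F.pullback (slice K 0)) s ≫ prism K F α =
      transportIncl F (simplexCylinder K s) (0, v₀ n)
        ((intervalMap α).prodMk (ContinuousMap.id _)) :=
  Sigma.ι_desc _ _

lemma prism_naturality (K : C(I × A, B)) (F : LocalSystem B) {m n : SimplexCategory} (θ : m ⟶ n)
    (α : n ⟶ ⦋1⦌) :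
    prism K F α ≫ chainMap F θ = chainMap (F.pullback (slice K 0)) θ ≫ prism K F (θ ≫ α) := by
  apply Sigma.hom_ext
  intro s
  have h : transport (F.pullback (slice K 0)) s (v₀ n) (simpMap θ (v₀ m)) =
      transportAlong F (simplexCylinder K s) (0, v₀ n) (0, simpMap θ (v₀ m)) :=
    (transport_pullback (slice K 0) F s _ _).trans
      (transportAlong_precomp F (simplexCylinder K s) (cylinderSlice n 0) _ _)
  have h' := (chainIncl_prism K F (θ ≫ α) (s.comp (simpMap θ))).trans
    (transportIncl_precomp F (simplexCylinder K s) ((ContinuousMap.id I).prodMap (simpMap θ))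
      (0, v₀ m) ((intervalMap (θ ≫ α)).prodMk (ContinuousMap.id _)))
  refine (Category.assoc _ _ _).symm.trans ((congrArg (· ≫ chainMap F θ)
    (chainIncl_prism K F α s)).trans ((transportIncl_chainMap F _ _ θ _).trans ?_))
  refine Eq.trans ?_ ((Category.assoc _ _ _).symm.trans ((congrArg (· ≫ prism K F (θ ≫ α))
    (chainIncl_chainMap _ θ s)).trans ((Category.assoc _ _ _).trans
      (congr (congrArg CategoryStruct.comp h) h')))).symm
  refine Eq.trans ?_ (transportAlong_transportIncl F (simplexCylinder K s) (0, v₀ n)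
    (0, simpMap θ (v₀ m)) _).symm
  rw [intervalMap_comp]
  rfl

/-- A homotopy induces a simplicial homotopy on chains, once coefficients are transported along
its tracks. -/
def chainsHomotopy (K : C(I × A, B)) (F : LocalSystem B) :
    SimplicialObject.Homotopy (pushChains (slice K 0) F)
      (coeffChains (trackTransport K F) ≫ pushChains (slice K 1) F) :=
  simplicialHomotopyOfCylinder (fun α => prism K F α) (fun θ α => prism_naturality K F θ α)
    (fun n => by
      apply Sigma.hom_ext
      intro s
      have h : intervalMap (SimplexCategory.toMk₁ (Fin.last (n + 1))) =
          ContinuousMap.const _ 0 := ContinuousMap.ext (intervalMap_last n)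
      refine (chainIncl_prism K F _ s).trans
        (Eq.trans ?_ (chainIncl_pushChain (slice K 0) F s).symm)
      rw [h]
      exact transportIncl_self F (simplexCylinder K s) (cylinderSlice ⦋n⦌ 0))
    (fun n => by
      apply Sigma.hom_ext
      intro s
      have h : intervalMap (SimplexCategory.toMk₁ (0 : Fin (n + 2))) =
          ContinuousMap.const _ 1 := ContinuousMap.ext (intervalMap_zero n)
      change _ = chainIncl _ s ≫ coeffChain (trackTransport K F) ⦋n⦌ ≫
        pushChain (slice K 1) F ⦋n⦌
      rw [chainIncl_prism, h, ← Category.assoc, chainIncl_coeffChain, Category.assoc,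
        chainIncl_pushChain, trackTransport_app]
      rfl)

lemma inducesHomologyIso_slice_iff (K : C(I × A, B)) (F : LocalSystem B) :
    InducesHomologyIso (slice K 0) F ↔ InducesHomologyIso (slice K 1) F := by
  rw [inducesHomologyIso_iff, inducesHomologyIso_iff]
  refine forall_congr' fun n => ?_
  have h := (chainsHomotopy K F).map_homology_eq n
  change (simplicialHomology n).map _ = (simplicialHomology n).map _ at h
  rw [h, Functor.map_comp]
  exact isIso_comp_left_iff _ _

/-- A self-map homotopic to the identity induces an isomorphism on homology, for all
coefficients. -/
lemma inducesHomologyIso_of_homotopic_id {f : C(A, A)} (h : f.Homotopic (ContinuousMap.id A))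
    (F : LocalSystem A) : InducesHomologyIso f F := by
  obtain ⟨H⟩ := h
  have h0 : slice H.toContinuousMap 0 = f := ContinuousMap.ext H.apply_zero
  have h1 : slice H.toContinuousMap 1 = ContinuousMap.id A := ContinuousMap.ext H.apply_one
  rw [← h0, inducesHomologyIso_slice_iff, h1]
  exact inducesHomologyIso_id F

/-- A map with a right homotopy inverse is surjective on homology, for all coefficients. -/
lemma epi_homologyMap_of_rightHomotopyInverse {i : C(A, B)} {g : C(B, A)}
    (h : (i.comp g).Homotopic (ContinuousMap.id B)) (F : LocalSystem B) (n : ℕ) :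
    Epi (homologyMap i F n) :=
  have := (inducesHomologyIso_comp_iff i g F).1 (inducesHomologyIso_of_homotopic_id h F) n
  epi_of_epi (homologyMap g (F.pullback i) n) _

/-- A homotopy equivalence induces an isomorphism on homology, for all coefficients. -/
lemma inducesHomologyIso_of_homotopyInverse {i : C(A, B)} {g : C(B, A)}
    (h : (i.comp g).Homotopic (ContinuousMap.id B))
    (h' : (g.comp i).Homotopic (ContinuousMap.id A)) (F : LocalSystem B) :
    InducesHomologyIso i F := by
  intro n
  -- Two out of six for the string `i`, `g`, `i`: the map induced by `g` with coefficients pulled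
  -- back along `i` is surjective since `g ∘ i ≃ id`, and injective since `i ∘ g ≃ id`.
  have hig := (inducesHomologyIso_comp_iff i g F).1 (inducesHomologyIso_of_homotopic_id h F) n
  have : Epi (homologyMap g (F.pullback i) n) := epi_homologyMap_of_rightHomotopyInverse h' _ n
  have : Mono (homologyMap g (F.pullback i) n) := mono_of_mono _ (homologyMap i F n)
  have : IsIso (homologyMap g (F.pullback i) n) := isIso_of_mono_of_epi _
  exact (isIso_comp_left_iff _ _).1 hig

end Homotopy

/-! ### Prepending paths -/

section Prepend

variable {P X : Type*} [TopologicalSpace P] [TopologicalSpace X]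

/-- Two families of paths `γ` and `δ` with a common initial point, glued to a family of maps
`ℝ → X` which is `γ` on `[0, 1]` and the reverse of `δ` on `[-1, 0]`. -/
def gluePaths (γ δ : C(P × I, X)) (h : ∀ p, γ (p, 0) = δ (p, 0)) : C(P × ℝ, X) where
  toFun q := if 0 ≤ q.2 then γ (q.1, Set.projIcc 0 1 zero_le_one q.2)
    else δ (q.1, Set.projIcc 0 1 zero_le_one (-q.2))
  continuous_toFun := by
    refine Continuous.if_le ?_ ?_ continuous_const continuous_snd ?_
    · exact γ.continuous.comp
        (continuous_fst.prodMk (continuous_projIcc.comp continuous_snd))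
    · exact δ.continuous.comp
        (continuous_fst.prodMk (continuous_projIcc.comp continuous_snd.neg))
    · intro q hq
      simpa [← hq] using h q.1

lemma gluePaths_of_nonneg (γ δ : C(P × I, X)) (h : ∀ p, γ (p, 0) = δ (p, 0)) (p : P) (t : I) :
    gluePaths γ δ h (p, t) = γ (p, t) := by
  refine (if_pos t.2.1).trans ?_
  rw [Set.projIcc_val]

lemma gluePaths_of_nonpos (γ δ : C(P × I, X)) (h : ∀ p, γ (p, 0) = δ (p, 0)) (p : P) (t : I) :
    gluePaths γ δ h (p, -(t : ℝ)) = δ (p, t) := by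
  by_cases ht : (t : ℝ) = 0
  · obtain rfl : t = 0 := Subtype.ext ht
    simpa using (gluePaths_of_nonneg γ δ h p 0).trans (h p)
  · refine (if_neg ?_).trans ?_
    · have := lt_of_le_of_ne t.2.1 (Ne.symm ht)
      simpa using this
    · rw [neg_neg, Set.projIcc_val]

lemma gluePaths_mem {γ δ : C(P × I, X)} {h : ∀ p, γ (p, 0) = δ (p, 0)} {Z : Set X} {p : P}
    (hγ : ∀ t, γ (p, t) ∈ Z) (hδ : ∀ t, δ (p, t) ∈ Z) (x : ℝ) : gluePaths γ δ h (p, x) ∈ Z := by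
  change (if _ then _ else _) ∈ Z
  split_ifs
  · exact hγ _
  · exact hδ _

/-- The family of paths which run back along `δ` from time `ℓ` to time `0` and then along `γ`,
parametrized at constant speed `1 + ℓ`. -/
def prependPaths (γ δ : C(P × I, X)) (h : ∀ p, γ (p, 0) = δ (p, 0)) (ℓ : C(P, I)) :
    C(P, C(I, X)) :=
  ContinuousMap.curry ((gluePaths γ δ h).comp
    ⟨fun q : P × I => (q.1, (1 + (ℓ q.1 : ℝ)) * q.2 - ℓ q.1), by fun_prop⟩)

variable {γ δ : C(P × I, X)} {h : ∀ p, γ (p, 0) = δ (p, 0)} {ℓ : C(P, I)}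

lemma prependPaths_apply (p : P) (t : I) : prependPaths γ δ h ℓ p t =
    gluePaths γ δ h (p, (1 + (ℓ p : ℝ)) * t - ℓ p) :=
  rfl

lemma prependPaths_zero (p : P) : prependPaths γ δ h ℓ p 0 = δ (p, ℓ p) := by
  rw [prependPaths_apply, ← gluePaths_of_nonpos γ δ h]
  simp

lemma prependPaths_one (p : P) : prependPaths γ δ h ℓ p 1 = γ (p, 1) := by
  rw [prependPaths_apply, ← gluePaths_of_nonneg γ δ h]
  simp

lemma prependPaths_of_length_zero {p : P} (hp : ℓ p = 0) (t : I) :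
    prependPaths γ δ h ℓ p t = γ (p, t) := by
  rw [prependPaths_apply, ← gluePaths_of_nonneg γ δ h, hp]
  simp

lemma prependPaths_mem {Z : Set X} {p : P} (hγ : ∀ t, γ (p, t) ∈ Z) (hδ : ∀ t, δ (p, t) ∈ Z)
    (t : I) : prependPaths γ δ h ℓ p t ∈ Z :=
  gluePaths_mem (h := h) hγ hδ _

/-- The paths prepended at a parameter only depend on the paths at that parameter. -/
lemma prependPaths_congr {Q : Type*} [TopologicalSpace Q] {γ' δ' : C(Q × I, X)}
    {h' : ∀ q, γ' (q, 0) = δ' (q, 0)} {ℓ' : C(Q, I)} {p : P} {q : Q}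
    (hγ : ∀ t, γ (p, t) = γ' (q, t)) (hδ : ∀ t, δ (p, t) = δ' (q, t)) (hℓ : ℓ p = ℓ' q) :
    prependPaths γ δ h ℓ p = prependPaths γ' δ' h' ℓ' q := by
  ext t
  simp only [prependPaths_apply, hℓ, gluePaths, ContinuousMap.coe_mk, hγ, hδ]

end Prepend

/-! ### Homotopy fibers over a contractible base -/

section Contraction

variable {X : Type*} [TopologicalSpace X] {V : Set X} {c : X}

/-- The path from `u` to `z` inside `V` which follows a contraction `h` of `V` from `u` to the
center, and then follows it backwards to `z`. -/
def contractionPath (h : C(I × V, V)) (h₁ : ∀ u, (h (1, u) : X) = c) (z : V) : C(V × I, X) :=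
  (gluePaths
    (⟨fun q => h (unitInterval.symm q.2, z), by fun_prop⟩ : C(V × I, X))
    (⟨fun q => h (unitInterval.symm q.2, q.1), by fun_prop⟩ : C(V × I, X))
    (fun u => by simp [h₁])).comp
  ⟨fun q => (q.1, 2 * (q.2 : ℝ) - 1), by fun_prop⟩

variable {h : C(I × V, V)} {h₁ : ∀ u, (h (1, u) : X) = c} {z : V}

lemma contractionPath_mem (u : V) (t : I) : contractionPath h h₁ z (u, t) ∈ V :=
  gluePaths_mem (h := fun u => by simp [h₁]) (fun _ => Subtype.coe_prop _)
    (fun _ => Subtype.coe_prop _) _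

lemma contractionPath_zero (h₀ : ∀ u, h (0, u) = u) (u : V) :
    contractionPath h h₁ z (u, 0) = u := by
  have := gluePaths_of_nonpos
    (⟨fun q => h (unitInterval.symm q.2, z), by fun_prop⟩ : C(V × I, X))
    (⟨fun q => h (unitInterval.symm q.2, q.1), by fun_prop⟩ : C(V × I, X))
    (fun u => by simp [h₁]) u 1
  simpa [contractionPath, h₀] using this

lemma contractionPath_one (h₀ : ∀ u, h (0, u) = u) (u : V) :
    contractionPath h h₁ z (u, 1) = z := by
  have := gluePaths_of_nonneg
    (⟨fun q => h (unitInterval.symm q.2, z), by fun_prop⟩ : C(V × I, X))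
    (⟨fun q => h (unitInterval.symm q.2, q.1), by fun_prop⟩ : C(V × I, X))
    (fun u => by simp [h₁]) u 1
  norm_num [contractionPath, h₀] at this ⊢
  exact this

/-- The contraction path from `z` to itself retraces its steps. -/
lemma contractionPath_self (t : I) : contractionPath h h₁ z (z, t) =
    h (Set.projIcc 0 1 zero_le_one (min (2 * t) (2 - 2 * t) : ℝ), z) := by
  have ht := t.2
  have key : ∀ s : I, (s : ℝ) = min (2 * (t : ℝ)) (2 - 2 * t) →
      h (s, z) = h (Set.projIcc 0 1 zero_le_one (min (2 * t) (2 - 2 * t) : ℝ), z) := by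
    intro s hs
    rw [← hs, Set.projIcc_val]
  change (if _ then _ else _) = _
  split_ifs with h2
  · refine congrArg Subtype.val (key _ ?_)
    dsimp only [ContinuousMap.coe_mk] at h2 ⊢
    rw [unitInterval.coe_symm_eq, Set.projIcc_of_mem _ ⟨h2, by linarith [ht.2]⟩,
      min_eq_right (by linarith)]
    ring
  · refine congrArg Subtype.val (key _ ?_)
    dsimp only [ContinuousMap.coe_mk] at h2 ⊢
    rw [unitInterval.coe_symm_eq, Set.projIcc_of_mem _ ⟨by linarith, by linarith [ht.1]⟩,
      min_eq_left (by linarith)]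
    ring

end Contraction

section HofibBase

variable {X Y : Type u} [TopologicalSpace X] [TopologicalSpace Y]

/-- The inclusion `hofib_V(r|_Z) → hofib_W(r|_Z)` for `V ⊆ W`. -/
def hofibBaseIncl (r : C(Y, X)) (Z : Set X) {V W : Set X} (h : V ⊆ W) :
    C(Hofib r Z V, Hofib r Z W) where
  toFun p := ⟨p.1, p.2.1, h p.2.2.1, p.2.2.2⟩
  continuous_toFun := continuous_subtype_val.subtype_mk _

variable (r : C(Y, X)) {Z V : Set X} {c : X}

/-- The evaluation at time `t` of the path of `p`, in the family indexed by time and by points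
of a homotopy fiber. -/
def hofibPaths (Z V : Set X) : C((I × Hofib r Z V) × I, X) where
  toFun q := q.1.2.1.1 q.2
  continuous_toFun := by fun_prop

/-- If `V` contracts in itself, the inclusion of the homotopy fiber over a point `z` of `V` into
the one over `V` is a homotopy equivalence: its inverse prepends the contraction paths to `z`. -/
lemma inducesHomologyIso_hofibBaseIncl (hVZ : V ⊆ Z) (h : C(I × V, V))
    (h₀ : ∀ u, h (0, u) = u) (h₁ : ∀ u, (h (1, u) : X) = c) (z : V)
    (F : LocalSystem (Hofib r Z V)) :
    InducesHomologyIso (hofibBaseIncl r Z (Set.singleton_subset_iff.2 z.2)) F := by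
  -- At time `s`, prepend the part of the contraction path up to time `s`.
  let δ : C((I × Hofib r Z V) × I, X) :=
    (contractionPath h h₁ z).comp
      ⟨fun q => (⟨q.1.2.1.1 0, q.1.2.2.2.1⟩, q.2), by fun_prop⟩
  have hδ : ∀ q, hofibPaths r Z V (q, 0) = δ (q, 0) :=
    fun q => (contractionPath_zero (h₁ := h₁) h₀ ⟨q.2.1.1 0, q.2.2.2.1⟩).symm
  let K : C(I × Hofib r Z V, C(I, X)) := prependPaths (hofibPaths r Z V) δ hδ ContinuousMap.fst
  have hKZ (q) (t) : K q t ∈ Z :=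
    prependPaths_mem (δ := δ) (fun t => q.2.2.1 t)
      (fun t => hVZ (contractionPath_mem (h₁ := h₁) ⟨q.2.1.1 0, q.2.2.2.1⟩ t)) t
  have hK0 (q) : K q 0 ∈ V := by
    rw [prependPaths_zero]
    exact contractionPath_mem (h₁ := h₁) _ _
  have hK1 (q) : K q 1 = r q.2.1.2 := (prependPaths_one q).trans q.2.2.2.2
  have hKz (p) : K (1, p) 0 = z := (prependPaths_zero _).trans (contractionPath_one (h₁ := h₁) h₀ _)
  -- At time `s`, prepend the loop at `z` which runs along the contraction for time `s` and
  -- comes back.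
  let δ' : C((I × Hofib r Z {z.1}) × I, X) :=
    ⟨fun q => h (Set.projIcc 0 1 zero_le_one
      (min (2 * (q.2 : ℝ)) (2 * (q.1.1 : ℝ) - 2 * q.2)), z), by
      have : Continuous (Set.projIcc (0 : ℝ) 1 zero_le_one) := continuous_projIcc
      fun_prop⟩
  have hδ' : ∀ q, hofibPaths r Z {z.1} (q, 0) = δ' (q, 0) := by
    intro q
    have hz : q.2.1.1 0 = z := q.2.2.2.1
    have hq : min 0 (2 * (q.1 : ℝ)) = 0 := min_eq_left (by have := q.1.2.1; linarith)
    simp [hofibPaths, δ', hz, hq, h₀]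
  let K' : C(I × Hofib r Z {z.1}, C(I, X)) :=
    prependPaths (hofibPaths r Z {z.1}) δ' hδ' ContinuousMap.fst
  have hKZ' (q) (t) : K' q t ∈ Z :=
    prependPaths_mem (fun t => q.2.2.1 t) (fun t => hVZ (Subtype.coe_prop _)) t
  have hK0' (q) : K' q 0 = z := by
    refine (prependPaths_zero q).trans ?_
    have hq : min (2 * (q.1 : ℝ)) 0 = 0 := min_eq_right (by have := q.1.2.1; linarith)
    simp [δ', hq, h₀]
  have hK1' (q) : K' q 1 = r q.2.1.2 := (prependPaths_one q).trans q.2.2.2.2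
  let g : C(Hofib r Z V, Hofib r Z {z.1}) :=
    ⟨fun p => ⟨(K (1, p), p.1.2), hKZ _, hKz p, hK1 (1, p)⟩, by fun_prop⟩
  refine inducesHomologyIso_of_homotopyInverse (g := g) (Nonempty.intro ?_) (Nonempty.intro ?_) F
  · refine ContinuousMap.Homotopy.symm
      { toFun := fun q => ⟨(K q, q.2.1.2), hKZ q, hK0 q, hK1 q⟩
        continuous_toFun := by fun_prop
        map_zero_left := fun p => ?_
        map_one_left := fun p => rfl }
    refine Subtype.ext (Prod.ext (ContinuousMap.ext fun t => ?_) rfl)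
    exact prependPaths_of_length_zero rfl t
  · refine ContinuousMap.Homotopy.symm
      { toFun := fun q => ⟨(K' q, q.2.1.2), hKZ' q, hK0' q, hK1' q⟩
        continuous_toFun := by fun_prop
        map_zero_left := fun p => ?_
        map_one_left := fun p => ?_ }
    · refine Subtype.ext (Prod.ext (ContinuousMap.ext fun t => ?_) rfl)
      exact prependPaths_of_length_zero rfl t
    · refine Subtype.ext (Prod.ext (prependPaths_congr (fun t => rfl) (fun t => ?_) rfl) rfl)
      have hz : (⟨p.1.1 0, Set.singleton_subset_iff.2 z.2 p.2.2.1⟩ : V) = z :=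
        Subtype.ext p.2.2.1
      refine Eq.trans ?_ ((congrArg (fun u => contractionPath h h₁ z (u, t)) hz).trans
        (contractionPath_self (h₁ := h₁) t)).symm
      simp [δ']

end HofibBase

/-! ### From the Serre condition to the Leray condition -/

section SerreLeray

variable {X Y : Type u} [TopologicalSpace X] [TopologicalSpace Y]

lemma LocalSystem.IsAbelian.pullback {A B : Type u} [TopologicalSpace A] [TopologicalSpace B]
    {F : LocalSystem B} (hF : F.IsAbelian) (f : C(A, B)) : (F.pullback f).IsAbelian := by
  intro x p q
  have := hF ((FundamentalGroupoid.map f).obj x) ((FundamentalGroupoid.map f).map p)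
    ((FundamentalGroupoid.map f).map q)
  refine Eq.trans (congrArg F.map ?_) this
  simp only [Groupoid.inv_eq_inv, Functor.map_comp, Functor.map_inv]

lemma contractibleSpace_of_hasLiftedDeformation {r : C(Y, X)} {Z : Set X} {U : Set Z} {c : Z}
    (hc : c ∈ U) (h : HasLiftedDeformation r (Subtype.val '' U) c.1) : ContractibleSpace U := by
  obtain ⟨h, -, h₀, h₁, -⟩ := h
  let e : U ≃ₜ (Subtype.val '' U : Set X) :=
    Topology.IsEmbedding.subtypeVal.homeomorphImage U
  have : ContractibleSpace (Subtype.val '' U : Set X) := by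
    rw [contractible_iff_id_nullhomotopic]
    exact ⟨⟨c, c, hc, rfl⟩, ⟨{ toContinuousMap := h
                               map_zero_left := h₀
                               map_one_left := fun u => Subtype.ext (h₁ u) }⟩⟩
  exact e.contractibleSpace

/-- The heart of the argument, for a fixed coefficient system: if `V` contracts to `c` compatibly
with a deformation of `r⁻¹(V)`, the Serre condition at all points of `V` implies the Leray
condition at all points of `V`. -/
lemma lerayCondition_of_serreCondition (r : C(Y, X)) {Z V : Set X} (hVZ : V ⊆ Z) {c : X}
    (hc : c ∈ V) (hd : HasLiftedDeformation r V c) (F : LocalSystem (Hofib r Set.univ V))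
    (hS : ∀ (z : X) (hz : z ∈ V), SerreCondition r Z ⟨z, hVZ hz⟩
      (F.pullback (hofibBaseIncl r Set.univ (Set.singleton_subset_iff.2 hz))))
    {z : X} (hz : z ∈ V) : LerayCondition r hz F := by
  obtain ⟨h, H, h₀, h₁, H₀, hH⟩ := hd
  let M : LocalSystem (Hofib r Z V) := F.pullback (hofibIncl r (Set.subset_univ Z) V)
  let b : C(r ⁻¹' V, Hofib r Z V) := toHofib r hVZ
  let a (x : X) (hx : x ∈ V) : C(r ⁻¹' {x}, r ⁻¹' V) :=
    preimageIncl r (Set.singleton_subset_iff.2 hx)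
  -- `r⁻¹(x) → hofib_x(r|_Z) → hofib_V(r|_Z)` is also `r⁻¹(x) → r⁻¹(V) → hofib_V(r|_Z)`.
  have hab (x : X) (hx : x ∈ V) (n : ℕ) :
      IsIso (homologyMap (a x hx) (M.pullback b) n ≫ homologyMap b M n) := by
    let d : C(Hofib r Z {x}, Hofib r Z V) := hofibBaseIncl r Z (Set.singleton_subset_iff.2 hx)
    let i : C(r ⁻¹' {x}, Hofib r Z {x}) := toHofib r (Set.singleton_subset_iff.2 (hVZ hx))
    have hi : InducesHomologyIso i (M.pullback d) :=
      (hS x hx).congr (pullbackComp _ _ F ≪≫ (pullbackComp _ _ F).symm)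
    have hdM : InducesHomologyIso d M :=
      inducesHomologyIso_hofibBaseIncl r hVZ h h₀ h₁ ⟨x, hx⟩ M
    have hdi : InducesHomologyIso (d.comp i) M := by
      rw [inducesHomologyIso_comp_iff]
      intro n
      have := hi n
      have := hdM n
      infer_instance
    exact (inducesHomologyIso_comp_iff b (a x hx) M).1 hdi n
  have hb : InducesHomologyIso b M := by
    intro n
    -- The end of the deformation is a right homotopy inverse of the inclusion of the fiber.
    let g : C(r ⁻¹' V, r ⁻¹' {c}) :=
      ⟨fun y => ⟨H (1, y), (hH 1 y).trans (h₁ _)⟩, by fun_prop⟩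
    have hg : ((a c hc).comp g).Homotopic (ContinuousMap.id _) :=
      ContinuousMap.Homotopic.symm ⟨{ toContinuousMap := H
                                      map_zero_left := H₀
                                      map_one_left := fun _ => rfl }⟩
    have := hab c hc n
    have : Epi (homologyMap (a c hc) (M.pullback b) n) :=
      epi_homologyMap_of_rightHomotopyInverse hg _ n
    have : Mono (homologyMap (a c hc) (M.pullback b) n) := mono_of_mono _ (homologyMap b M n)
    have : IsIso (homologyMap (a c hc) (M.pullback b) n) := isIso_of_mono_of_epi _
    exact (isIso_comp_left_iff _ _).1 (hab c hc n)
  have ha : InducesHomologyIso (a z hz) (M.pullback b) := by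
    intro n
    have := hb n
    exact (isIso_comp_right_iff _ _).1 (hab z hz n)
  exact ha.congr (pullbackComp _ _ F)

end SerreLeray

end TwistedHomology

end

theorem mainTheorem11 {X Y : Type u} [TopologicalSpace X] [TopologicalSpace Y]
    (r : C(Y, X)) (Z : Set X)
    (hZ : ∀ z : Z, ∀ N ∈ 𝓝 z, ∃ U : Set Z, U ⊆ N ∧ IsOpen U ∧ z ∈ U ∧
      TwistedHomology.HasLiftedDeformation r (Subtype.val '' U) z) :
    (TwistedHomology.IsTwistedSerreOn r Z → TwistedHomology.IsTwistedLerayOn r Z) ∧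
      (TwistedHomology.IsAbelianSerreOn r Z → TwistedHomology.IsAbelianLerayOn r Z) := by
  let 𝓤 : Set (Set Z) := {U | IsOpen U ∧ ∃ z ∈ U,
    TwistedHomology.HasLiftedDeformation r (Subtype.val '' U) z.1}
  have hbasis : TopologicalSpace.IsTopologicalBasis 𝓤 := by
    refine TopologicalSpace.isTopologicalBasis_of_isOpen_of_nhds (fun U hU => hU.1) ?_
    intro z N hz hN
    obtain ⟨U, hUN, hU, hzU, hd⟩ := hZ z N (hN.mem_nhds hz)
    exact ⟨U, ⟨hU, z, hzU, hd⟩, hzU, hUN⟩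
  have hcontr : ∀ U ∈ 𝓤, ContractibleSpace U := fun U ⟨_, z, hz, hd⟩ =>
    TwistedHomology.contractibleSpace_of_hasLiftedDeformation hz hd
  refine ⟨fun hS => ⟨𝓤, hbasis, hcontr, ?_⟩, fun hS => ⟨𝓤, hbasis, hcontr, ?_⟩⟩
  · rintro U ⟨_, c, hc, hd⟩ z hz F
    exact TwistedHomology.lerayCondition_of_serreCondition r (Subtype.coe_image_subset Z U)
      ⟨c, hc, rfl⟩ hd F (fun x hx => hS _ _) hz
  · rintro U ⟨_, c, hc, hd⟩ z hz F hF
    exact TwistedHomology.lerayCondition_of_serreCondition r (Subtype.coe_image_subset Z U)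
      ⟨c, hc, rfl⟩ hd F (fun x hx => hS _ _ (hF.pullback _)) hz
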